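/- **Setting.** $N$ processes have distinct positions in $\mathbb R^2$ and binary inputs; communication is synchronous, every process may send a message to every other one in each round, senders cannot be spoofed, and messages are oral (unsigned). Exactly the processes whose position lies in a closed square $F$ (interior or boundary) are Byzantine, i.e. behave arbitrarily; $f$ is their number. The position (and, in (i) and (iii), the orientation) of $F$ is unknown to the processes. An algorithm solves *geoconsensus* if in each of its computations the correct processes output irrevocable decisions such that no two correct processes decide differently (agreement), if all correct processes have input $v$ then every correct process decides $v$ (validity), and every correct process eventually decides (termination). **Cover set.** Let $\ell>0$. The set $\mathcal A$ of closed axis-aligned $\ell\times\ell$ cover squares is computed greedily. The bottom of the first slab is the least $y$-coordinate of a process, the bottom of each next slab is the least $y$-coordinate of a process not covered by the previous slabs, and the slab with bottom $y$ is the strip between the heights $y$ and $y+\ell$. Within a slab, the left side of the first square is at the least $x$-coordinate of a process of the slab, and the left side of each next square is at the least $x$-coordinate of a process of the slab not covered by the previous squares; all these squares have their bottom side on the bottom of the slab. **GENERIC.** The algorithm uses a bound $n$ on the number of cover squares that $F$ can overlap. The *leader* of a cover square is the process covered by it with the smallest $y$-coordinate and, among those, the smallest $x$-coordinate. The leaders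 run the Pease–Shostak–Lamport oral-message interactive consistency algorithm for at most $n$ faults ($n+1$ rounds), decide the majority value of the resulting vector, and broadcast this decision in one more round. Every other process decides $v$ upon having received the decision $v$ from at least $2n+1$ leaders. **Theorem.** GENERIC solves geoconsensus with one fault area $F$, with the following guarantees. (i) If $|\mathcal A|\ge 22$, then for every $\ell\times\ell$ square $F$, in any location and not necessarily axis-aligned, at most $N-15$ processes are faulty, that is, $f\le N-15$, and GENERIC with $n=7$ solves geoconsensus. (ii) If $|\mathcal A|\ge 13$, then for every axis-aligned $\ell\times\ell$ square $F$ one has $f\le N-9$, and GENERIC with $n=4$ solves geoconsensus. (iii) If $|\mathcal A|\ge 13$, then for every $\frac{\ell}{\sqrt2}\times\frac{\ell}{\sqrt2}$ square $F$, in any location and not necessarily axis-aligned, one has $f\le N-9$, and GENERIC with $n=4$ solves geoconsensus. In each case all correct processes have decided after $n+2$ communication rounds. -/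

import Mathlib

noncomputable section

open scoped Classical

namespace Geoconsensus

/-! ### Synchronous algorithms with Byzantine faults -/

/-- A deterministic synchronous message-passing algorithm for `N` processes with binary inputs.
In each round every process sends one message to every process, then updates its local state
from the messages received; the receiver knows the true sender of each message. -/
structure Algorithm (N : ℕ) where
  State : Type
  Msg : Type
  /-- initial local state of a process with a given input -/
  init : Fin N → Bool → State
  /-- message sent by a process, in a given local state, to a given recipient -/
  send : Fin N → State → Fin N → Msg
  /-- new local state, from the old one and the messages received (indexed by the sender) -/
  recv : Fin N → State → (Fin N → Msg) → State
  /-- the decision output so far, if any -/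
  output : State → Option Bool

/-- `state r p` is the local state of `p` after `r` rounds, and `msg r p q` is the message from
`p` to `q` in the round that follows. Correct processes obey the algorithm; the messages
of the faulty processes are unconstrained, and so may differ from recipient to recipient. -/
structure IsComputation {N : ℕ} (G : Algorithm N) (faulty : Finset (Fin N))
    (input : Fin N → Bool) (state : ℕ → Fin N → G.State)
    (msg : ℕ → Fin N → Fin N → G.Msg) : Prop where
  init_eq : ∀ p, p ∉ faulty → state 0 p = G.init p (input p)
  send_eq : ∀ r p, p ∉ faulty → ∀ q, msg r p q = G.send p (state r p) q
  recv_eq : ∀ r p, p ∉ faulty → state (r + 1) p = G.recv p (state r p) (fun q => msg r q p)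

/-- The consensus properties of one computation, given through the decisions `dec r p` that the
processes have output after `r` rounds. -/
structure Consensus {N : ℕ} (faulty : Finset (Fin N)) (input : Fin N → Bool)
    (dec : ℕ → Fin N → Option Bool) : Prop where
  irrevocable : ∀ r p v, p ∉ faulty → dec r p = some v → dec (r + 1) p = some v
  agreement : ∀ r r' p q v w, p ∉ faulty → q ∉ faulty →
    dec r p = some v → dec r' q = some w → v = w
  validity : ∀ v, (∀ p, p ∉ faulty → input p = v) →
    ∀ r p w, p ∉ faulty → dec r p = some w → w = v
  termination : ∀ p, p ∉ faulty → ∃ r v, dec r p = some v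

/-- The processes covered by the (closed) area `F`; these are exactly the faulty ones. -/
def covered {N : ℕ} (pos : Fin N → ℝ × ℝ) (F : Set (ℝ × ℝ)) : Finset (Fin N) :=
  Finset.univ.filter (fun p => pos p ∈ F)

/-- Every computation in which exactly the processes covered by `F` are Byzantine satisfies the
consensus properties. -/
def SolvesGeoconsensus {N : ℕ} (G : Algorithm N) (pos : Fin N → ℝ × ℝ)
    (F : Set (ℝ × ℝ)) : Prop :=
  ∀ input state msg, IsComputation G (covered pos F) input state msg →
    Consensus (covered pos F) input (fun r p => G.output (state r p))

/-- In every computation in which exactly the processes covered by `F` are Byzantine, all correct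
processes have decided after `T` rounds. -/
def DecidesWithin {N : ℕ} (G : Algorithm N) (pos : Fin N → ℝ × ℝ)
    (F : Set (ℝ × ℝ)) (T : ℕ) : Prop :=
  ∀ input state msg, IsComputation G (covered pos F) input state msg →
    ∀ p, p ∉ covered pos F → ∃ v, G.output (state T p) = some v

/-! ### Squares -/

/-- The closed axis-aligned square with bottom left corner `a` and the given side. -/
def axisSquare (a : ℝ × ℝ) (side : ℝ) : Set (ℝ × ℝ) :=
  {z | a.1 ≤ z.1 ∧ z.1 ≤ a.1 + side ∧ a.2 ≤ z.2 ∧ z.2 ≤ a.2 + side}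

/-- The closed square with one corner `a` and the given side, rotated about `a` by `θ`. -/
def rotatedSquare (a : ℝ × ℝ) (θ side : ℝ) : Set (ℝ × ℝ) :=
  {z | ∃ s ∈ Set.Icc 0 side, ∃ t ∈ Set.Icc 0 side,
    z = (a.1 + s * Real.cos θ - t * Real.sin θ, a.2 + s * Real.sin θ + t * Real.cos θ)}

/-! ### The greedy square cover -/

/-- Greedy cover of a finite set of reals by intervals `[a, a + ℓ]`: the first interval starts at
the least element, and the procedure continues with the elements not yet covered.
The result is the set of the left ends of the intervals. -/
def greedyAnchors (ℓ : ℝ) (S : Finset ℝ) : Finset ℝ :=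
  if h : S.Nonempty then
    insert (S.min' h)
      (greedyAnchors ℓ ((S.erase (S.min' h)).filter (fun x => S.min' h + ℓ < x)))
  else ∅
termination_by S.card
decreasing_by
  exact lt_of_le_of_lt (Finset.card_filter_le _ _)
    (Finset.card_erase_lt_of_mem (S.min'_mem h))

/-- The heights of the bottom sides of the slabs. -/
def slabs {N : ℕ} (pos : Fin N → ℝ × ℝ) (ℓ : ℝ) : Finset ℝ :=
  greedyAnchors ℓ (Finset.univ.image (fun p => (pos p).2))

/-- The abscissas of the left sides of the cover squares in the slab with bottom side at `y`. -/
def slabSquares {N : ℕ} (pos : Fin N → ℝ × ℝ) (ℓ y : ℝ) : Finset ℝ :=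
  greedyAnchors ℓ
    ((Finset.univ.filter (fun p => y ≤ (pos p).2 ∧ (pos p).2 ≤ y + ℓ)).image
      (fun p => (pos p).1))

/-- The cover set computed by the greedy square cover algorithm: the bottom left
corners of the `ℓ × ℓ` axis-aligned cover squares. -/
def coverSet {N : ℕ} (pos : Fin N → ℝ × ℝ) (ℓ : ℝ) : Finset (ℝ × ℝ) :=
  (slabs pos ℓ).biUnion (fun y => (slabSquares pos ℓ y).image (fun x => (x, y)))

/-- `p` is the leader of the cover square with corner `c`: the covered process with least
`y`-coordinate, and with least `x`-coordinate among those. -/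
def IsLeader {N : ℕ} (pos : Fin N → ℝ × ℝ) (ℓ : ℝ) (c : ℝ × ℝ) (p : Fin N) : Prop :=
  pos p ∈ axisSquare c ℓ ∧ ∀ q, pos q ∈ axisSquare c ℓ →
    (pos p).2 < (pos q).2 ∨ ((pos p).2 = (pos q).2 ∧ (pos p).1 ≤ (pos q).1)

/-- The set of leaders, one for each cover square. -/
def leaders {N : ℕ} (pos : Fin N → ℝ × ℝ) (ℓ : ℝ) : Finset (Fin N) :=
  Finset.univ.filter (fun p => ∃ c ∈ coverSet pos ℓ, IsLeader pos ℓ c p)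

/-! ### The consensus algorithm of Pease, Shostak and Lamport (oral messages)

In each of `m + 1` rounds every participant relays to every participant what it received in the
round before, starting with its own input. Afterwards a participant holds a
table `τ` indexed by strings of participants: `τ []` is its own input and `τ [q₁, …, qᵣ]` is the
value that `q₁` told it that `q₂` told `q₁` that … that `qᵣ` told `qᵣ₋₁` is the input of `qᵣ`. -/

/-- Some `Q ⊆ P` with more than `(|P| + m) / 2` members supports the value `v` for `q`: all
reports about `q` relayed through at most `m` members of `Q` are `v`. -/
def Supports {N : ℕ} (m : ℕ) (P : Finset (Fin N)) (τ : List (Fin N) → Bool)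
    (q : Fin N) (v : Bool) : Prop :=
  ∃ Q ⊆ P, P.card + m < 2 * Q.card ∧
    ∀ w : List (Fin N), (∀ x ∈ w, x ∈ Q) → w.length ≤ m → τ (w ++ [q]) = v

/-- The value that a participant with table `τ` records for `q`, `none` being the value NIL. If no
value is supported, the procedure is applied recursively, with fault parameter `m - 1`, to the
participants other than `q` and to the values that they obtained from `q`. -/
def pslRecord {N : ℕ} : (m : ℕ) → (P : Finset (Fin N)) → (τ : List (Fin N) → Bool) →
    Fin N → Option Bool
  | 0, P, τ, q =>
      if Supports 0 P τ q true then some true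
      else if Supports 0 P τ q false then some false
      else none
  | m + 1, P, τ, q =>
      if Supports (m + 1) P τ q true then some true
      else if Supports (m + 1) P τ q false then some false
      else
        let count : Bool → ℕ := fun v =>
          ((P.erase q).filter
            (fun r => pslRecord m (P.erase q) (fun w => τ (w ++ [q])) r = some v)).card
        if (P.card + (m + 1)) / 2 ≤ count true then some true
        else if (P.card + (m + 1)) / 2 ≤ count false then some false
        else none

/-- The decision: the majority value of the recorded vector (`false` in case of a tie). -/
def pslDecide {N : ℕ} (m : ℕ) (P : Finset (Fin N)) (τ : List (Fin N) → Bool) : Bool :=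
  decide ((P.filter (fun q => pslRecord m P τ q = some false)).card <
    (P.filter (fun q => pslRecord m P τ q = some true)).card)

/-! ### Algorithm GENERIC -/

/-- `report` carries the relayed values; in the round after `r` rounds only the values at
strings of length `r` are used. `announce` carries a decision. -/
inductive GMsg (N : ℕ) where
  | silent
  | report (vals : List (Fin N) → Bool)
  | announce (v : Bool)

structure GState (N : ℕ) where
  /-- number of completed rounds -/
  round : ℕ
  /-- the table of the values received -/
  table : List (Fin N) → Bool
  /-- the leaders that have announced a given value -/
  heard : Bool → Finset (Fin N)
  decision : Option Bool

/-- The value that a message reports for the string `w`; a missing report counts as `false`. -/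
def GMsg.value {N : ℕ} (μ : GMsg N) (w : List (Fin N)) : Bool :=
  match μ with
  | .report vals => vals w
  | _ => false

def genericSend {N : ℕ} (L : Finset (Fin N)) (m : ℕ) (p : Fin N) (s : GState N)
    (q : Fin N) : GMsg N :=
  if p ∈ L then
    if s.round ≤ m then
      if q ∈ L then .report (fun w => if w.length = s.round then s.table w else false)
      else .silent
    else if s.round = m + 1 then
      match s.decision with
      | some v => .announce v
      | none => .silent
    else .silent
  else .silent

/-- The table after the next round: the string `q :: w` gets the value that `q` reports for `w`. -/
def updateTable {N : ℕ} (s : GState N) (inbox : Fin N → GMsg N) : List (Fin N) → Bool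
  | [] => s.table []
  | q :: w => if w.length = s.round then (inbox q).value w else s.table (q :: w)

def updateHeard {N : ℕ} (L : Finset (Fin N)) (s : GState N) (inbox : Fin N → GMsg N)
    (v : Bool) : Finset (Fin N) :=
  s.heard v ∪ L.filter (fun q => inbox q = .announce v)

/-- Leaders decide after the `m + 1` rounds of the Pease-Shostak-Lamport algorithm. The other
processes wait for identical decisions from at least `2 * m + 1` leaders. -/
def genericRecv {N : ℕ} (L : Finset (Fin N)) (m : ℕ) (p : Fin N) (s : GState N)
    (inbox : Fin N → GMsg N) : GState N where
  round := s.round + 1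
  table := updateTable s inbox
  heard := updateHeard L s inbox
  decision :=
    match s.decision with
    | some v => some v
    | none =>
      if p ∈ L then
        if s.round = m then some (pslDecide m L (updateTable s inbox)) else none
      else if 2 * m + 1 ≤ (updateHeard L s inbox true).card then some true
      else if 2 * m + 1 ≤ (updateHeard L s inbox false).card then some false
      else none

/-- Algorithm GENERIC for processes at the positions `pos`, with cover squares of side `ℓ` and
with the bound `m` on the number of cover squares that the fault area can overlap. -/
def generic {N : ℕ} (pos : Fin N → ℝ × ℝ) (ℓ : ℝ) (m : ℕ) : Algorithm N where
  State := GState N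
  Msg := GMsg N
  init := fun _ b => ⟨0, fun _ => b, fun _ => ∅, none⟩
  send := genericSend (leaders pos ℓ) m
  recv := genericRecv (leaders pos ℓ) m
  output := GState.decision

end Geoconsensus

end

noncomputable section

open scoped Classical

namespace Geoconsensus

/-! ### Interactive consistency of the Pease-Shostak-Lamport algorithm -/

/-! The proof joins a geometric count to oral-message consensus. Cover squares are pairwise
disjoint, so distinct squares have distinct leaders. Hence there are at least 3m+1 leaders, and the
faulty ones are at most as many as the squares that F overlaps, say at most m. At least 2m+1 leaders
are then correct, and this also bounds f. They agree by interactive consistency and announce one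
value, whereas at most m leaders can announce the other; so the threshold 2m+1 is reached by the
right value only (`generic_correct`).

Consistency (`Relayed.pslRecord_congr`) is by induction on m. Values of correct participants are
supported by the set of all correct ones. For a faulty q, the recursion removes q and one unit of
the fault bound. Two supporting quorums share a correct relay, and a value supported at one
participant reaches the recursive threshold at every correct one.

For the count, slab bottoms, and left sides within a slab, are more than ℓ apart, so an extent of at
most ℓ meets two of them and one of at most 2ℓ meets three. Projections of length at most ℓ give 2·2
= 4 squares. A rotated ℓ-square has diagonal √2 ℓ, and two slabs give at most 6. If it meets three
slabs, its part in each extreme slab has width at most ℓ, because a triangle inside it has area at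
most ℓ²/2; the total is 2 + 3 + 2 = 7 (`card_overlapped_le_seven`). -/

theorem Supports.eq {N m : ℕ} {P : Finset (Fin N)} {τ : List (Fin N) → Bool} {q : Fin N}
    {v : Bool} (h : Supports m P τ q v) : τ [q] = v := by
  obtain ⟨Q, -, -, hw⟩ := h
  simpa using hw [] (by simp) (by simp)

/-- The empty relay string forces a supported value to be `τ [q]`, so two values are never supported
at once and the order of the tests is immaterial. -/
theorem pslRecord_of_supports {N m : ℕ} {P : Finset (Fin N)} {τ : List (Fin N) → Bool}
    {q : Fin N} {v : Bool} (h : Supports m P τ q v) : pslRecord m P τ q = some v := by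
  have hv := h.eq
  cases v with
  | true => cases m <;> simp [pslRecord, h]
  | false =>
    have ht : ¬ Supports m P τ q true := fun h' => by simp [h'.eq] at hv
    cases m <;> simp [pslRecord, h, ht]

/-- The number of participants other than `q` for which the recursive call records `v`. -/
def tally {N : ℕ} (m : ℕ) (P : Finset (Fin N)) (τ : List (Fin N) → Bool) (q : Fin N)
    (v : Bool) : ℕ :=
  ((P.erase q).filter
    (fun r => pslRecord m (P.erase q) (fun w => τ (w ++ [q])) r = some v)).card

theorem pslRecord_succ_of_not_supports {N m : ℕ} {P : Finset (Fin N)}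
    {τ : List (Fin N) → Bool} {q : Fin N} (h : ∀ v, ¬ Supports (m + 1) P τ q v) :
    pslRecord (m + 1) P τ q =
      if (P.card + (m + 1)) / 2 ≤ tally m P τ q true then some true
      else if (P.card + (m + 1)) / 2 ≤ tally m P τ q false then some false
      else none := by
  rw [pslRecord, if_neg (h true), if_neg (h false)]
  rfl

theorem tally_true_add_tally_false_le {N : ℕ} (m : ℕ) (P : Finset (Fin N))
    (τ : List (Fin N) → Bool) (q : Fin N) :
    tally m P τ q true + tally m P τ q false ≤ (P.erase q).card := by
  unfold tally
  rw [← Finset.card_union_of_disjoint]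
  · exact Finset.card_le_card
      (Finset.union_subset (Finset.filter_subset _ _) (Finset.filter_subset _ _))
  · rw [Finset.disjoint_filter]
    intro r _ h h'
    simp [h] at h'

/-- If a value reaches the threshold in the recursive call, it is the value recorded. -/
theorem pslRecord_succ_of_le_tally {N m : ℕ} {P : Finset (Fin N)}
    {τ : List (Fin N) → Bool} {q : Fin N} {v : Bool} (hq : q ∈ P)
    (h : ∀ v, ¬ Supports (m + 1) P τ q v) (hv : (P.card + (m + 1)) / 2 ≤ tally m P τ q v) :
    pslRecord (m + 1) P τ q = some v := by
  rw [pslRecord_succ_of_not_supports h]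
  have hsum := tally_true_add_tally_false_le m P τ q
  have hpos : 0 < P.card := Finset.card_pos.2 ⟨q, hq⟩
  rw [Finset.card_erase_of_mem hq] at hsum
  cases v with
  | true => simp [hv]
  | false =>
    -- Twice the threshold is at least `P.card`, more than the `P.card - 1` voters, so `true` cannot
    -- reach it as well.
    rw [if_neg (by omega), if_pos hv]

/-- A supported value reaches the threshold in the recursive call. -/
theorem Supports.le_tally {N m : ℕ} {P : Finset (Fin N)} {τ : List (Fin N) → Bool}
    {q : Fin N} {v : Bool} (hq : q ∈ P) (h : Supports (m + 1) P τ q v) :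
    (P.card + (m + 1)) / 2 ≤ tally m P τ q v := by
  obtain ⟨Q, hQP, hcard, hw⟩ := h
  have hQ : Q.card - 1 ≤ (Q.erase q).card := Finset.pred_card_le_card_erase
  have hpos : 0 < P.card := Finset.card_pos.2 ⟨q, hq⟩
  refine le_trans (show _ ≤ (Q.erase q).card by omega) (Finset.card_le_card ?_)
  intro r hr
  -- Each `r ≠ q` in `Q` has its value supported by `Q.erase q` in the recursive call: appending `r`
  -- to a relay string of length at most `m` gives one allowed for `Q`.
  rw [Finset.mem_filter]
  refine ⟨Finset.erase_subset_erase q hQP hr, pslRecord_of_supports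
    ⟨Q.erase q, Finset.erase_subset_erase q hQP, ?_, ?_⟩⟩
  · rw [Finset.card_erase_of_mem hq]
    omega
  · intro w hwQ hlen
    refine hw (w ++ [r]) ?_ (by simpa using hlen)
    intro x hx
    rcases List.mem_append.1 hx with hx | hx
    · exact Finset.mem_of_mem_erase (hwQ x hx)
    · rw [List.mem_singleton.1 hx]
      exact Finset.mem_of_mem_erase hr

/-- The correct participants `C` hold tables `τ` in which they report each other's tables
faithfully, up to strings of length `m`. -/
def Relayed {N : ℕ} (m : ℕ) (C : Finset (Fin N)) (τ : Fin N → List (Fin N) → Bool) : Prop :=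
  ∀ p ∈ C, ∀ c ∈ C, ∀ w : List (Fin N), w.length ≤ m → τ p (c :: w) = τ c w

/-- Correct relays are peeled off one by one until `q`'s own entry remains. -/
theorem Relayed.append_singleton {N m : ℕ} {C : Finset (Fin N)}
    {τ : Fin N → List (Fin N) → Bool} (h : Relayed m C τ) {q : Fin N} (hq : q ∈ C)
    (w : List (Fin N)) : ∀ p ∈ C, (∀ x ∈ w, x ∈ C) → w.length ≤ m →
      τ p (w ++ [q]) = τ q [] := by
  induction w with
  | nil => exact fun p hp _ _ => h p hp q hq [] (by simp)
  | cons c w ih =>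
    intro p hp hw hlen
    simp only [List.length_cons] at hlen
    have hc : c ∈ C := hw c (by simp)
    rw [List.cons_append, h p hp c hc _ (by simpa using hlen)]
    exact ih c hc (fun x hx => hw x (by simp [hx])) (by omega)

theorem Relayed.pslRecord_eq {N m : ℕ} {P C : Finset (Fin N)}
    {τ : Fin N → List (Fin N) → Bool} (h : Relayed m C τ) (hCP : C ⊆ P)
    (hfaulty : P.card ≤ C.card + m) (hP : 3 * m < P.card) {p q : Fin N} (hp : p ∈ C)
    (hq : q ∈ C) : pslRecord m P (τ p) q = some (τ q []) :=
  -- The quorum is `C` itself; `3 * m < P.card` makes it large enough.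
  pslRecord_of_supports ⟨C, hCP, by omega, fun w hw hlen =>
    h.append_singleton hq w p hp hw hlen⟩

/-- Two sets, each with more than half of `|P| + m` elements, share a correct participant. -/
theorem exists_mem_inter_of_quorums {N m : ℕ} {P C Q Q' : Finset (Fin N)} (hCP : C ⊆ P)
    (hfaulty : P.card ≤ C.card + m) (hQ : Q ⊆ P) (hQ' : Q' ⊆ P)
    (hcard : P.card + m < 2 * Q.card) (hcard' : P.card + m < 2 * Q'.card) :
    ∃ c ∈ C, c ∈ Q ∧ c ∈ Q' := by
  have h1 := Finset.card_union_add_card_inter Q Q'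
  have h2 := Finset.card_le_card (Finset.union_subset hQ hQ')
  have h3 := Finset.card_union_add_card_inter (Q ∩ Q') C
  have h4 := Finset.card_le_card
    (Finset.union_subset (Finset.inter_subset_left.trans hQ : Q ∩ Q' ⊆ P) hCP)
  -- The quorums overlap in more than `m` participants, of which at most `m` lie outside `C`.
  obtain ⟨c, hc⟩ : ((Q ∩ Q') ∩ C).Nonempty := Finset.card_pos.1 (by omega)
  simp only [Finset.mem_inter] at hc
  exact ⟨c, hc.2, hc.1⟩

/-- Agreement on faulty `q` as well. `C` stays fixed in the induction: only a faulty `q` is erased,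
so both `P.card ≤ C.card + m` and `3 * m < P.card` pass to the recursive call. -/
theorem Relayed.pslRecord_congr {N : ℕ} {C : Finset (Fin N)} {p p' : Fin N} (hp : p ∈ C)
    (hp' : p' ∈ C) (m : ℕ) : ∀ (P : Finset (Fin N)) (τ : Fin N → List (Fin N) → Bool),
      Relayed m C τ → C ⊆ P → P.card ≤ C.card + m → 3 * m < P.card →
      ∀ q ∈ P, pslRecord m P (τ p) q = pslRecord m P (τ p') q := by
  induction m with
  | zero =>
    intro P τ h hCP hfaulty hP q hq
    have hq' : q ∈ C := by rwa [Finset.eq_of_subset_of_card_le hCP hfaulty]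
    rw [h.pslRecord_eq hCP hfaulty hP hp hq', h.pslRecord_eq hCP hfaulty hP hp' hq']
  | succ m ih =>
    intro P τ h hCP hfaulty hP q hq
    by_cases hqC : q ∈ C
    · rw [h.pslRecord_eq hCP hfaulty hP hp hqC, h.pslRecord_eq hCP hfaulty hP hp' hqC]
    have hrec : ∀ r ∈ P.erase q,
        pslRecord m (P.erase q) (fun w => τ p (w ++ [q])) r =
          pslRecord m (P.erase q) (fun w => τ p' (w ++ [q])) r := by
      have hcard := Finset.card_erase_of_mem hq
      refine ih (P.erase q) (fun c w => τ c (w ++ [q])) ?_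
        (Finset.subset_erase.2 ⟨hCP, hqC⟩) (by omega) (by omega)
      intro a ha c hc w hlen
      exact h a ha c hc (w ++ [q]) (by simpa using hlen)
    have htally : ∀ v, tally m P (τ p) q v = tally m P (τ p') q v := by
      intro v
      unfold tally
      congr 1
      exact Finset.filter_congr fun r hr => by rw [hrec r hr]
    by_cases hs : ∃ v, Supports (m + 1) P (τ p) q v <;>
      by_cases hs' : ∃ v, Supports (m + 1) P (τ p') q v
    · obtain ⟨v, hv⟩ := hs
      obtain ⟨v', hv'⟩ := hs'
      rw [pslRecord_of_supports hv, pslRecord_of_supports hv']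
      obtain ⟨Q, hQ, hcard, hw⟩ := hv
      obtain ⟨Q', hQ', hcard', hw'⟩ := hv'
      obtain ⟨c, hc, hcQ, hcQ'⟩ :=
        exists_mem_inter_of_quorums hCP hfaulty hQ hQ' hcard hcard'
      -- Both values are what the shared correct `c` reports about `q`, and `c` tells everyone the
      -- same.
      rw [← hw [c] (by simpa using hcQ) (by simp), ← hw' [c] (by simpa using hcQ') (by simp)]
      simp only [List.cons_append, List.nil_append]
      rw [h p hp c hc _ (by simp), h p' hp' c hc _ (by simp)]
    · obtain ⟨v, hv⟩ := hs
      rw [pslRecord_of_supports hv]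
      -- Support at `p` makes the tally reach the threshold; the tally at `p'` is the same.
      exact (pslRecord_succ_of_le_tally hq (not_exists.1 hs')
        (htally v ▸ hv.le_tally hq)).symm
    · obtain ⟨v, hv⟩ := hs'
      rw [pslRecord_of_supports hv]
      exact pslRecord_succ_of_le_tally hq (not_exists.1 hs)
        ((htally v).symm ▸ hv.le_tally hq)
    · rw [pslRecord_succ_of_not_supports (not_exists.1 hs),
        pslRecord_succ_of_not_supports (not_exists.1 hs'), htally, htally]

theorem Relayed.pslDecide_congr {N m : ℕ} {P C : Finset (Fin N)}
    {τ : Fin N → List (Fin N) → Bool} (h : Relayed m C τ) (hCP : C ⊆ P)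
    (hfaulty : P.card ≤ C.card + m) (hP : 3 * m < P.card) {p p' : Fin N} (hp : p ∈ C)
    (hp' : p' ∈ C) : pslDecide m P (τ p) = pslDecide m P (τ p') := by
  have hr := Relayed.pslRecord_congr hp hp' m P τ h hCP hfaulty hP
  unfold pslDecide
  rw [Finset.filter_congr fun q hq => by rw [hr q hq],
    Finset.filter_congr (p := fun q => pslRecord m P (τ p) q = some true)
      fun q hq => by rw [hr q hq]]

/-- All of `C` is recorded with `v`, and only the at most `m` others can be recorded with the
opposite value. -/
theorem Relayed.pslDecide_eq {N m : ℕ} {P C : Finset (Fin N)}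
    {τ : Fin N → List (Fin N) → Bool} (h : Relayed m C τ) (hCP : C ⊆ P)
    (hfaulty : P.card ≤ C.card + m) (hP : 3 * m < P.card) {p : Fin N} (hp : p ∈ C)
    {v : Bool} (hv : ∀ q ∈ C, τ q [] = v) : pslDecide m P (τ p) = v := by
  have hC : ∀ q ∈ C, pslRecord m P (τ p) q = some v := fun q hq => by
    rw [h.pslRecord_eq hCP hfaulty hP hp hq, hv q hq]
  have hge : C.card ≤ (P.filter (fun q => pslRecord m P (τ p) q = some v)).card :=
    Finset.card_le_card fun q hq => Finset.mem_filter.2 ⟨hCP hq, hC q hq⟩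
  have hle : (P.filter (fun q => pslRecord m P (τ p) q = some !v)).card ≤ (P \ C).card := by
    refine Finset.card_le_card fun q hq => ?_
    rw [Finset.mem_filter] at hq
    refine Finset.mem_sdiff.2 ⟨hq.1, fun hqC => ?_⟩
    have := (hC q hqC).symm.trans hq.2
    cases v <;> simp at this
  have hcard := Finset.card_sdiff_add_card_eq_card hCP
  unfold pslDecide
  cases v with
  | true =>
    simp only [Bool.not_true] at hle
    exact decide_eq_true (by omega)
  | false =>
    simp only [Bool.not_false] at hle
    exact decide_eq_false (by omega)

/-! ### Computations of GENERIC -/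

section Computations

variable {N : ℕ} {pos : Fin N → ℝ × ℝ} {ℓ : ℝ} {m : ℕ} {faulty : Finset (Fin N)}
  {input : Fin N → Bool} {state : ℕ → Fin N → GState N} {msg : ℕ → Fin N → Fin N → GMsg N}

theorem generic_state_zero (h : IsComputation (generic pos ℓ m) faulty input state msg)
    {p : Fin N} (hp : p ∉ faulty) :
    state 0 p = ⟨0, fun _ => input p, fun _ => ∅, none⟩ :=
  h.init_eq p hp

theorem generic_msg (h : IsComputation (generic pos ℓ m) faulty input state msg)
    {p : Fin N} (hp : p ∉ faulty) (r : ℕ) (q : Fin N) :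
    msg r p q = genericSend (leaders pos ℓ) m p (state r p) q :=
  h.send_eq r p hp q

theorem generic_state_succ (h : IsComputation (generic pos ℓ m) faulty input state msg)
    {p : Fin N} (hp : p ∉ faulty) (r : ℕ) :
    state (r + 1) p = genericRecv (leaders pos ℓ) m p (state r p) (fun q => msg r q p) :=
  h.recv_eq r p hp

theorem generic_round (h : IsComputation (generic pos ℓ m) faulty input state msg)
    {p : Fin N} (hp : p ∉ faulty) (r : ℕ) : (state r p).round = r := by
  induction r with
  | zero => rw [generic_state_zero h hp]
  | succ r ih => rw [generic_state_succ h hp, genericRecv, ih]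

theorem generic_table_nil (h : IsComputation (generic pos ℓ m) faulty input state msg)
    {p : Fin N} (hp : p ∉ faulty) (r : ℕ) : (state r p).table [] = input p := by
  induction r with
  | zero => rw [generic_state_zero h hp]
  | succ r ih => rw [generic_state_succ h hp, ← ih]; rfl

/-- The entries of the table for the strings of length at most `r` are final after `r` rounds. -/
theorem generic_table_of_length_le
    (h : IsComputation (generic pos ℓ m) faulty input state msg) {p : Fin N} (hp : p ∉ faulty)
    (w : List (Fin N)) {r : ℕ} (hr : w.length ≤ r) :
    (state r p).table w = (state w.length p).table w := by
  induction r, hr using Nat.le_induction with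
  | base => rfl
  | succ r hr ih =>
    rw [generic_state_succ h hp, genericRecv, ← ih]
    cases w with
    | nil => rfl
    | cons q w =>
      rw [List.length_cons] at hr
      simp only [updateTable]
      rw [if_neg]
      rw [generic_round h hp]
      omega

/-- Correct leaders report each other's tables faithfully. -/
theorem generic_relayed (h : IsComputation (generic pos ℓ m) faulty input state msg) :
    Relayed m (leaders pos ℓ \ faulty) (fun p => (state (m + 1) p).table) := by
  intro p hp c hc w hw
  rw [Finset.mem_sdiff] at hp hc
  dsimp only
  -- Both entries are traced to the time of relaying: `p` fills in `c :: w` from what `c` holds for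
  -- `w` after `w.length` rounds.
  rw [generic_table_of_length_le h hp.2 (c :: w) (by simpa using hw),
    generic_table_of_length_le h hc.2 w (by omega), List.length_cons,
    generic_state_succ h hp.2, genericRecv]
  simp only [updateTable]
  rw [if_pos (generic_round h hp.2 _).symm, generic_msg h hc.2, genericSend, if_pos hc.1,
    generic_round h hc.2, if_pos hw, if_pos hp.1]
  simp [GMsg.value]

theorem generic_decision_succ (h : IsComputation (generic pos ℓ m) faulty input state msg)
    {p : Fin N} (hp : p ∉ faulty) {r : ℕ} {v : Bool} (hv : (state r p).decision = some v) :
    (state (r + 1) p).decision = some v := by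
  rw [generic_state_succ h hp, genericRecv]
  simp only [hv]

theorem generic_leader_decision_of_le
    (h : IsComputation (generic pos ℓ m) faulty input state msg) {p : Fin N}
    (hp : p ∈ leaders pos ℓ \ faulty) {r : ℕ} (hr : r ≤ m) : (state r p).decision = none := by
  rw [Finset.mem_sdiff] at hp
  induction r with
  | zero => rw [generic_state_zero h hp.2]
  | succ r ih =>
    rw [generic_state_succ h hp.2, genericRecv]
    simp only [ih (by omega), generic_round h hp.2]
    rw [if_pos hp.1, if_neg (by omega)]

/-- The decision is made in the step from `m` to `m + 1`, using the table updated in that same step,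
and then kept. -/
theorem generic_leader_decision_of_lt
    (h : IsComputation (generic pos ℓ m) faulty input state msg) {p : Fin N}
    (hp : p ∈ leaders pos ℓ \ faulty) {r : ℕ} (hr : m < r) :
    (state r p).decision =
      some (pslDecide m (leaders pos ℓ) (state (m + 1) p).table) := by
  have hp' := Finset.mem_sdiff.1 hp
  induction r, hr using Nat.le_induction with
  | base =>
    have hnone := generic_leader_decision_of_le h hp le_rfl
    rw [Nat.succ_eq_add_one, generic_state_succ h hp'.2, genericRecv]
    simp only [hnone, generic_round h hp'.2]
    rw [if_pos hp'.1, if_pos trivial]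
  | succ r hr ih => exact generic_decision_succ h hp'.2 ih

/-- A correct leader announces only its decision. -/
theorem generic_msg_announce (h : IsComputation (generic pos ℓ m) faulty input state msg)
    {q : Fin N} (hq : q ∈ leaders pos ℓ \ faulty) {r : ℕ} {p : Fin N} {v : Bool}
    (hv : msg r q p = .announce v) :
    v = pslDecide m (leaders pos ℓ) (state (m + 1) q).table := by
  have hq' := Finset.mem_sdiff.1 hq
  rw [generic_msg h hq'.2, genericSend, if_pos hq'.1, generic_round h hq'.2] at hv
  by_cases hr : r ≤ m
  · rw [if_pos hr] at hv
    split_ifs at hv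
  · rw [if_neg hr, generic_leader_decision_of_lt h hq (by omega)] at hv
    split_ifs at hv
    simpa using hv.symm

theorem generic_msg_eq_announce (h : IsComputation (generic pos ℓ m) faulty input state msg)
    {q : Fin N} (hq : q ∈ leaders pos ℓ \ faulty) (p : Fin N) :
    msg (m + 1) q p = .announce (pslDecide m (leaders pos ℓ) (state (m + 1) q).table) := by
  have hq' := Finset.mem_sdiff.1 hq
  rw [generic_msg h hq'.2, genericSend, if_pos hq'.1, generic_round h hq'.2,
    if_neg (by omega), if_pos rfl, generic_leader_decision_of_lt h hq (by omega)]

/-- If all correct leaders decide `d`, only faulty leaders announce another value. -/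
theorem generic_heard_subset (h : IsComputation (generic pos ℓ m) faulty input state msg)
    {d v : Bool} (hd : ∀ q ∈ leaders pos ℓ \ faulty,
      pslDecide m (leaders pos ℓ) (state (m + 1) q).table = d) (hv : v ≠ d)
    {p : Fin N} (hp : p ∉ faulty) (r : ℕ) :
    (state r p).heard v ⊆ leaders pos ℓ ∩ faulty := by
  induction r with
  | zero =>
    rw [generic_state_zero h hp]
    exact Finset.empty_subset _
  | succ r ih =>
    rw [generic_state_succ h hp, genericRecv]
    refine Finset.union_subset ih fun q hq => ?_
    rw [Finset.mem_filter] at hq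
    refine Finset.mem_inter.2 ⟨hq.1, ?_⟩
    by_contra hqf
    have hq' := Finset.mem_sdiff.2 ⟨hq.1, hqf⟩
    exact hv ((generic_msg_announce h hq' hq.2).trans (hd q hq'))

/-- A non-leader deciding otherwise would have heard the wrong value from `2 * m + 1` leaders, but
only the at most `m` faulty ones announce it. -/
theorem generic_decision_eq (h : IsComputation (generic pos ℓ m) faulty input state msg)
    (hf : (leaders pos ℓ ∩ faulty).card ≤ m) {d : Bool}
    (hd : ∀ q ∈ leaders pos ℓ \ faulty,
      pslDecide m (leaders pos ℓ) (state (m + 1) q).table = d)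
    {p : Fin N} (hp : p ∉ faulty) {r : ℕ} {v : Bool} (hv : (state r p).decision = some v) :
    v = d := by
  by_cases hpL : p ∈ leaders pos ℓ
  · have hp' := Finset.mem_sdiff.2 ⟨hpL, hp⟩
    rcases le_or_gt r m with hr | hr
    · simp [generic_leader_decision_of_le h hp' hr] at hv
    · rw [generic_leader_decision_of_lt h hp' hr, hd p hp'] at hv
      simpa using hv.symm
  · induction r with
    | zero => simp [generic_state_zero h hp] at hv
    | succ r ih =>
      cases hr : (state r p).decision with
      | some u =>
        rw [generic_decision_succ h hp hr] at hv
        exact ih (hr.trans hv)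
      | none =>
        by_contra hne
        have hle := (Finset.card_le_card (generic_heard_subset h hd hne hp (r + 1))).trans hf
        rw [generic_state_succ h hp, genericRecv] at hv hle
        simp only [hr, if_neg hpL] at hv hle
        split_ifs at hv with h1 h2
        · cases hv
          omega
        · cases hv
          omega

theorem generic_decides (h : IsComputation (generic pos ℓ m) faulty input state msg)
    (hc : 2 * m + 1 ≤ (leaders pos ℓ \ faulty).card) {d : Bool}
    (hd : ∀ q ∈ leaders pos ℓ \ faulty,
      pslDecide m (leaders pos ℓ) (state (m + 1) q).table = d)
    {p : Fin N} (hp : p ∉ faulty) : ∃ v, (state (m + 2) p).decision = some v := by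
  by_cases hpL : p ∈ leaders pos ℓ
  · exact ⟨_, generic_leader_decision_of_lt h (Finset.mem_sdiff.2 ⟨hpL, hp⟩) (by omega)⟩
  · cases hr : (state (m + 1) p).decision with
    | some u => exact ⟨u, generic_decision_succ h hp hr⟩
    | none =>
      have hsub : leaders pos ℓ \ faulty ⊆
          updateHeard (leaders pos ℓ) (state (m + 1) p) (fun q => msg (m + 1) q p) d := by
        intro q hq
        refine Finset.mem_union_right _ (Finset.mem_filter.2 ⟨(Finset.mem_sdiff.1 hq).1, ?_⟩)
        exact (generic_msg_eq_announce h hq p).trans (by rw [hd q hq])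
      have hle := hc.trans (Finset.card_le_card hsub)
      rw [generic_state_succ h hp, genericRecv]
      simp only [hr, if_neg hpL]
      cases d with
      | true => exact ⟨true, if_pos hle⟩
      | false =>
        -- Only the existence of a decision is needed, so the branch where `true` passes its test
        -- first need not be excluded.
        rw [if_pos hle]
        split_ifs <;> simp

/-- GENERIC is correct when at most `m` of at least `3 * m + 1` leaders are faulty. -/
theorem generic_correct {F : Set (ℝ × ℝ)} (hL : 3 * m < (leaders pos ℓ).card)
    (hf : (leaders pos ℓ ∩ covered pos F).card ≤ m) :
    SolvesGeoconsensus (generic pos ℓ m) pos F ∧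
      DecidesWithin (generic pos ℓ m) pos F (m + 2) := by
  have hcard := Finset.card_sdiff_add_card_inter (leaders pos ℓ) (covered pos F)
  have hdec : ∀ input (state : ℕ → Fin N → GState N) (msg : ℕ → Fin N → Fin N → GMsg N),
      IsComputation (generic pos ℓ m) (covered pos F) input state msg →
      ∃ d, (∀ q ∈ leaders pos ℓ \ covered pos F,
        pslDecide m (leaders pos ℓ) (state (m + 1) q).table = d) ∧
        ∀ v, (∀ p, p ∉ covered pos F → input p = v) → d = v := by
    intro input state msg h
    have hrel := generic_relayed h
    obtain ⟨c, hc⟩ : (leaders pos ℓ \ covered pos F).Nonempty :=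
      Finset.card_pos.1 (by omega)
    refine ⟨_, fun q hq => hrel.pslDecide_congr Finset.sdiff_subset (by omega) hL hq hc,
      fun v hv => hrel.pslDecide_eq Finset.sdiff_subset (by omega) hL hc fun q hq => ?_⟩
    have hq' := (Finset.mem_sdiff.1 hq).2
    exact (generic_table_nil h hq' _).trans (hv q hq')
  have hterm : DecidesWithin (generic pos ℓ m) pos F (m + 2) := by
    intro input state msg h p hp
    obtain ⟨d, hd, -⟩ := hdec input state msg h
    exact generic_decides h (by omega) hd hp
  refine ⟨fun input state msg h => ?_, hterm⟩
  obtain ⟨d, hd, hval⟩ := hdec input state msg h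
  refine ⟨fun r p v hp hv => generic_decision_succ h hp hv, ?_, ?_, ?_⟩
  · intro r r' p q v w hp hq hv hw
    rw [generic_decision_eq h hf hd hp hv, generic_decision_eq h hf hd hq hw]
  · intro v hv r p w hp hw
    rw [generic_decision_eq h hf hd hp hw, hval v hv]
  · exact fun p hp => ⟨m + 2, hterm input state msg h p hp⟩

end Computations

/-! ### Spaced sets of reals and the greedy cover -/

/-- Any two elements differ by more than `ℓ`. -/
def Spaced (ℓ : ℝ) (T : Finset ℝ) : Prop :=
  ∀ a ∈ T, ∀ b ∈ T, a < b → a + ℓ < b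

theorem Spaced.mono {ℓ : ℝ} {S T : Finset ℝ} (h : Spaced ℓ T) (hST : S ⊆ T) : Spaced ℓ S :=
  fun a ha b hb => h a (hST ha) b (hST hb)

/-- Removing the maximum leaves points more than `ℓ` below it. Strict spacing matters: a closed
interval of length exactly `(k + 1) * ℓ` cannot hold `k + 2` of them. -/
theorem Spaced.card_le_of_subset_Icc {ℓ : ℝ} (k : ℕ) :
    ∀ {T : Finset ℝ}, Spaced ℓ T → ∀ {lo hi : ℝ}, (∀ a ∈ T, lo ≤ a ∧ a ≤ hi) →
      hi - lo ≤ (k + 1) * ℓ → T.card ≤ k + 1 := by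
  induction k with
  | zero =>
    intro T hT lo hi hmem hle
    norm_num at hle
    rw [zero_add, Finset.card_le_one]
    intro a ha b hb
    by_contra hne
    rcases lt_or_gt_of_ne hne with hab | hab
    · linarith [hT a ha b hb hab, hmem a ha, hmem b hb]
    · linarith [hT b hb a ha hab, hmem a ha, hmem b hb]
  | succ k ih =>
    intro T hT lo hi hmem hle
    rcases T.eq_empty_or_nonempty with rfl | hne
    · simp
    have hM := T.max'_mem hne
    have hcard := Finset.card_erase_add_one hM
    have := ih (T := T.erase (T.max' hne)) (hT.mono (Finset.erase_subset _ _)) (lo := lo)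
      (hi := T.max' hne - ℓ) (fun a ha => by
        have ha' := Finset.mem_of_mem_erase ha
        have hlt := lt_of_le_of_ne (T.le_max' a ha') (Finset.ne_of_mem_erase ha)
        exact ⟨(hmem a ha').1, by linarith [hT a ha' _ hM hlt]⟩) (by
        push_cast at hle ⊢
        linarith [(hmem _ hM).2])
    omega

/-- If the intervals of length `ℓ` that start at the elements of a spaced set contain points
within distance `(k + 1) * ℓ` of each other, there are at most `k + 2` intervals. -/
theorem Spaced.card_le_of_witnesses {ℓ : ℝ} (k : ℕ) {T : Finset ℝ} (hT : Spaced ℓ T)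
    {x : ℝ → ℝ} (hx : ∀ a ∈ T, a ≤ x a ∧ x a ≤ a + ℓ)
    (hdist : ∀ a ∈ T, ∀ b ∈ T, x a - x b ≤ (k + 1) * ℓ) : T.card ≤ k + 2 := by
  rcases T.eq_empty_or_nonempty with rfl | hne
  · simp
  refine hT.card_le_of_subset_Icc (k + 1) (lo := T.min' hne) (hi := T.max' hne)
    (fun a ha => ⟨T.min'_le a ha, T.le_max' a ha⟩) ?_
  -- A witness exceeds its left end by at most `ℓ`, so the extreme left ends are at most `(k + 2) *
  -- ℓ` apart.
  have := hdist _ (T.max'_mem hne) _ (T.min'_mem hne)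
  push_cast
  linarith [(hx _ (T.max'_mem hne)).1, (hx _ (T.min'_mem hne)).2]

theorem greedyAnchors_subset (ℓ : ℝ) (S : Finset ℝ) : greedyAnchors ℓ S ⊆ S := by
  induction S using greedyAnchors.induct ℓ with
  | case1 S h ih =>
    rw [greedyAnchors, dif_pos h]
    exact Finset.insert_subset (S.min'_mem h)
      (ih.trans ((Finset.filter_subset _ _).trans (Finset.erase_subset _ _)))
  | case2 S h =>
    rw [greedyAnchors, dif_neg h]
    exact Finset.empty_subset _

theorem spaced_greedyAnchors (ℓ : ℝ) (S : Finset ℝ) : Spaced ℓ (greedyAnchors ℓ S) := by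
  induction S using greedyAnchors.induct ℓ with
  | case1 S h ih =>
    rw [greedyAnchors, dif_pos h]
    intro a ha b hb hab
    have hsub := greedyAnchors_subset ℓ ((S.erase (S.min' h)).filter (S.min' h + ℓ < ·))
    rcases Finset.mem_insert.1 ha with rfl | ha <;> rcases Finset.mem_insert.1 hb with rfl | hb
    · exact absurd hab (lt_irrefl _)
    · exact (Finset.mem_filter.1 (hsub hb)).2
    · have := (Finset.mem_filter.1 (hsub ha)).1
      exact absurd hab (not_lt.2 (S.min'_le a (Finset.mem_of_mem_erase this)))
    · exact ih a ha b hb hab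
  | case2 S h =>
    rw [greedyAnchors, dif_neg h]
    intro a ha
    simp at ha

/-! ### Cover squares and leaders -/

section Cover

variable {N : ℕ} {pos : Fin N → ℝ × ℝ} {ℓ : ℝ}

theorem mem_coverSet {c : ℝ × ℝ} :
    c ∈ coverSet pos ℓ ↔ c.2 ∈ slabs pos ℓ ∧ c.1 ∈ slabSquares pos ℓ c.2 := by
  obtain ⟨x, y⟩ := c
  simp only [coverSet, Finset.mem_biUnion, Finset.mem_image, Prod.mk.injEq]
  constructor
  · rintro ⟨y', hy', x', hx', rfl, rfl⟩
    exact ⟨hy', hx'⟩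
  · rintro ⟨hy, hx⟩
    exact ⟨y, hy, x, hx, rfl, rfl⟩

theorem spaced_slabs : Spaced ℓ (slabs pos ℓ) :=
  spaced_greedyAnchors _ _

theorem spaced_slabSquares {y : ℝ} : Spaced ℓ (slabSquares pos ℓ y) :=
  spaced_greedyAnchors _ _

/-- The cover squares are disjoint. -/
theorem coverSet_eq_of_mem {c d z : ℝ × ℝ} (hc : c ∈ coverSet pos ℓ) (hd : d ∈ coverSet pos ℓ)
    (hzc : z ∈ axisSquare c ℓ) (hzd : z ∈ axisSquare d ℓ) : c = d := by
  rw [mem_coverSet] at hc hd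
  obtain ⟨h1, h2, h3, h4⟩ := hzc
  obtain ⟨g1, g2, g3, g4⟩ := hzd
  have hy : c.2 = d.2 := by
    by_contra hne
    rcases lt_or_gt_of_ne hne with h | h
    · linarith [spaced_slabs _ hc.1 _ hd.1 h]
    · linarith [spaced_slabs _ hd.1 _ hc.1 h]
  refine Prod.ext ?_ hy
  rw [hy] at hc
  by_contra hne
  rcases lt_or_gt_of_ne hne with h | h
  · linarith [spaced_slabSquares _ hc.2 _ hd.2 h]
  · linarith [spaced_slabSquares _ hd.2 _ hc.2 h]

theorem exists_mem_axisSquare (hℓ : 0 < ℓ) {c : ℝ × ℝ} (hc : c ∈ coverSet pos ℓ) :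
    ∃ p, pos p ∈ axisSquare c ℓ := by
  have := greedyAnchors_subset _ _ (mem_coverSet.1 hc).2
  simp only [Finset.mem_image, Finset.mem_filter, Finset.mem_univ, true_and] at this
  obtain ⟨p, ⟨h1, h2⟩, h3⟩ := this
  exact ⟨p, h3.ge, by linarith, h1, h2⟩

theorem exists_isLeader (hℓ : 0 < ℓ) {c : ℝ × ℝ} (hc : c ∈ coverSet pos ℓ) :
    ∃ p, IsLeader pos ℓ c p := by
  obtain ⟨p₀, hp₀⟩ := exists_mem_axisSquare hℓ hc
  -- Coordinates are swapped so that the lexicographic order compares heights first.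
  obtain ⟨p, hp, hmin⟩ := Finset.exists_min_image
    (Finset.univ.filter fun p => pos p ∈ axisSquare c ℓ)
    (fun p => toLex ((pos p).2, (pos p).1)) ⟨p₀, by simpa using hp₀⟩
  simp only [Finset.mem_filter, Finset.mem_univ, true_and] at hp hmin
  exact ⟨p, hp, fun q hq => by simpa [Prod.Lex.toLex_le_toLex] using hmin q hq⟩

theorem IsLeader.eq (hpos : Function.Injective pos) {c : ℝ × ℝ} {p q : Fin N}
    (hp : IsLeader pos ℓ c p) (hq : IsLeader pos ℓ c q) : p = q := by
  apply hpos
  rcases hp.2 q hq.1 with h | ⟨h, h'⟩ <;> rcases hq.2 p hp.1 with g | ⟨g, g'⟩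
  · linarith
  · linarith
  · linarith
  · exact Prod.ext (le_antisymm h' g') h

theorem card_coverSet_le_card_leaders (hℓ : 0 < ℓ) :
    (coverSet pos ℓ).card ≤ (leaders pos ℓ).card := by
  refine Finset.card_le_card_of_forall_subsingleton (IsLeader pos ℓ) (fun c hc => ?_)
    fun p _ c hc d hd => coverSet_eq_of_mem hc.1 hd.1 hc.2.1 hd.2.1
  obtain ⟨p, hp⟩ := exists_isLeader hℓ hc
  exact ⟨p, Finset.mem_filter.2 ⟨Finset.mem_univ p, c, hc, hp⟩, hp⟩

/-- The cover squares that `F` overlaps. -/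
def overlapped (pos : Fin N → ℝ × ℝ) (ℓ : ℝ) (F : Set (ℝ × ℝ)) : Finset (ℝ × ℝ) :=
  (coverSet pos ℓ).filter fun c => (axisSquare c ℓ ∩ F).Nonempty

/-- A faulty leader lies in both `F` and its own square, and injectivity of `pos` leaves each square
a single leader. -/
theorem card_leaders_inter_covered_le (hpos : Function.Injective pos) (F : Set (ℝ × ℝ)) :
    (leaders pos ℓ ∩ covered pos F).card ≤ (overlapped pos ℓ F).card := by
  refine Finset.card_le_card_of_forall_subsingleton (fun p c => IsLeader pos ℓ c p)
    (fun p hp => ?_) fun c _ p hp q hq => hp.2.eq hpos hq.2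
  obtain ⟨hpL, hpF⟩ := Finset.mem_inter.1 hp
  obtain ⟨c, hc, hcp⟩ := (Finset.mem_filter.1 hpL).2
  exact ⟨c, Finset.mem_filter.2 ⟨hc, pos p, hcp.1, (Finset.mem_filter.1 hpF).2⟩, hcp⟩

/-- The guarantees of GENERIC, given a bound on the number of overlapped cover squares. -/
theorem generic_guarantees (hpos : Function.Injective pos) (hℓ : 0 < ℓ) {m : ℕ}
    (hA : 3 * m + 1 ≤ (coverSet pos ℓ).card) {F : Set (ℝ × ℝ)}
    (hF : (overlapped pos ℓ F).card ≤ m) :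
    (covered pos F).card + (2 * m + 1) ≤ N ∧ SolvesGeoconsensus (generic pos ℓ m) pos F ∧
      DecidesWithin (generic pos ℓ m) pos F (m + 2) := by
  have hL := card_coverSet_le_card_leaders (pos := pos) hℓ
  have hf := (card_leaders_inter_covered_le (ℓ := ℓ) hpos F).trans hF
  refine ⟨?_, generic_correct (by omega) hf⟩
  have h1 := Finset.card_sdiff_add_card_inter (leaders pos ℓ) (covered pos F)
  have h2 := Finset.card_union_of_disjoint
    (Finset.sdiff_disjoint : Disjoint (leaders pos ℓ \ covered pos F) (covered pos F))
  have h3 := Finset.card_le_univ ((leaders pos ℓ \ covered pos F) ∪ covered pos F)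
  rw [Fintype.card_fin] at h3
  omega

/-! ### Counting overlapped cover squares -/

/-- The left sides of the overlapped cover squares in the slab at height `y`. -/
def overlappedIn (pos : Fin N → ℝ × ℝ) (ℓ : ℝ) (F : Set (ℝ × ℝ)) (y : ℝ) : Finset ℝ :=
  (slabSquares pos ℓ y).filter fun x => (axisSquare (x, y) ℓ ∩ F).Nonempty

/-- The heights of the slabs in which some cover square is overlapped. -/
def overlappedSlabs (pos : Fin N → ℝ × ℝ) (ℓ : ℝ) (F : Set (ℝ × ℝ)) : Finset ℝ :=
  (overlapped pos ℓ F).image Prod.snd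

theorem card_overlapped_eq_sum (F : Set (ℝ × ℝ)) :
    (overlapped pos ℓ F).card =
      ∑ y ∈ overlappedSlabs pos ℓ F, (overlappedIn pos ℓ F y).card := by
  rw [overlappedSlabs, Finset.card_eq_sum_card_image Prod.snd]
  refine Finset.sum_congr rfl fun y hy => ?_
  obtain ⟨c, hc, rfl⟩ := Finset.mem_image.1 hy
  have hy' := (mem_coverSet.1 (Finset.mem_filter.1 hc).1).1
  refine Finset.card_bij (fun d _ => d.1) ?_ ?_ ?_
  · rintro ⟨x, y⟩ hd
    obtain ⟨hd, hdy⟩ := Finset.mem_filter.1 hd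
    obtain ⟨h1, h2⟩ := Finset.mem_filter.1 hd
    dsimp only at hdy
    subst hdy
    exact Finset.mem_filter.2 ⟨(mem_coverSet.1 h1).2, h2⟩
  · intro d hd e he hde
    exact Prod.ext hde ((Finset.mem_filter.1 hd).2.trans (Finset.mem_filter.1 he).2.symm)
  · intro x hx
    obtain ⟨h1, h2⟩ := Finset.mem_filter.1 hx
    exact ⟨(x, c.2), Finset.mem_filter.2
      ⟨Finset.mem_filter.2 ⟨mem_coverSet.2 ⟨hy', h1⟩, h2⟩, rfl⟩, rfl⟩

theorem exists_mem_of_mem_overlappedSlabs {F : Set (ℝ × ℝ)} {y : ℝ}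
    (hy : y ∈ overlappedSlabs pos ℓ F) : ∃ z ∈ F, y ≤ z.2 ∧ z.2 ≤ y + ℓ := by
  obtain ⟨c, hc, rfl⟩ := Finset.mem_image.1 hy
  obtain ⟨z, ⟨-, -, h1, h2⟩, hzF⟩ := (Finset.mem_filter.1 hc).2
  exact ⟨z, hzF, h1, h2⟩

theorem spaced_overlappedSlabs {F : Set (ℝ × ℝ)} : Spaced ℓ (overlappedSlabs pos ℓ F) := by
  refine spaced_slabs.mono (T := slabs pos ℓ) fun y hy => ?_
  obtain ⟨c, hc, rfl⟩ := Finset.mem_image.1 hy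
  exact (mem_coverSet.1 (Finset.mem_filter.1 hc).1).1

theorem card_overlappedSlabs_le (k : ℕ) {F : Set (ℝ × ℝ)}
    (hF : ∀ z ∈ F, ∀ w ∈ F, z.2 - w.2 ≤ (k + 1) * ℓ) :
    (overlappedSlabs pos ℓ F).card ≤ k + 2 := by
  have hex : ∀ y ∈ overlappedSlabs pos ℓ F, ∃ z ∈ F, y ≤ z.2 ∧ z.2 ≤ y + ℓ :=
    fun y hy => exists_mem_of_mem_overlappedSlabs hy
  choose! g hg using hex
  exact spaced_overlappedSlabs.card_le_of_witnesses k (x := fun y => (g y).2)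
    (fun y hy => (hg y hy).2) fun y hy y' hy' => hF _ (hg y hy).1 _ (hg y' hy').1

/-- Only the part of `F` inside the slab has to be narrow; this is what saves a square in each
extreme slab. -/
theorem card_overlappedIn_le (k : ℕ) {F : Set (ℝ × ℝ)} {y : ℝ}
    (hF : ∀ z ∈ F, ∀ w ∈ F, y ≤ z.2 → z.2 ≤ y + ℓ → y ≤ w.2 → w.2 ≤ y + ℓ →
      z.1 - w.1 ≤ (k + 1) * ℓ) :
    (overlappedIn pos ℓ F y).card ≤ k + 2 := by
  have hex : ∀ x ∈ overlappedIn pos ℓ F y, ∃ z, z ∈ axisSquare (x, y) ℓ ∧ z ∈ F :=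
    fun x hx => (Finset.mem_filter.1 hx).2
  choose! g hg using hex
  have hsp : Spaced ℓ (overlappedIn pos ℓ F y) :=
    spaced_slabSquares.mono (T := slabSquares pos ℓ y) (Finset.filter_subset _ _)
  refine hsp.card_le_of_witnesses k (x := fun x => (g x).1) (fun x hx => ?_)
    fun x hx x' hx' => ?_
  · obtain ⟨⟨h1, h2, -, -⟩, -⟩ := hg x hx
    exact ⟨h1, h2⟩
  · obtain ⟨⟨-, -, h1, h2⟩, h3⟩ := hg x hx
    obtain ⟨⟨-, -, g1, g2⟩, g3⟩ := hg x' hx'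
    exact hF _ h3 _ g3 h1 h2 g1 g2

/-- An area whose projections to the axes have length at most `ℓ` overlaps at most four cover
squares. -/
theorem card_overlapped_le_four {F : Set (ℝ × ℝ)}
    (hF : ∀ z ∈ F, ∀ w ∈ F, z.1 - w.1 ≤ ℓ ∧ z.2 - w.2 ≤ ℓ) :
    (overlapped pos ℓ F).card ≤ 4 := by
  have h1 : (overlappedSlabs pos ℓ F).card ≤ 2 :=
    card_overlappedSlabs_le 0 fun z hz w hw => by simpa using (hF z hz w hw).2
  have h2 : ∀ y ∈ overlappedSlabs pos ℓ F, (overlappedIn pos ℓ F y).card ≤ 2 := fun y _ =>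
    card_overlappedIn_le 0 fun z hz w hw _ _ _ _ => by simpa using (hF z hz w hw).1
  have h3 := Finset.sum_le_card_nsmul _ _ _ h2
  rw [card_overlapped_eq_sum]
  simp only [smul_eq_mul] at h3
  omega

/-- An area overlaps at most seven cover squares if its projections to the axes have length at most
`2 * ℓ` and any two of its points that are both higher, or both lower, by at least `ℓ` than some
third point have abscissas that differ by at most `ℓ`. -/
theorem card_overlapped_le_seven {F : Set (ℝ × ℝ)}
    (hF : ∀ z ∈ F, ∀ w ∈ F, z.1 - w.1 ≤ 2 * ℓ ∧ z.2 - w.2 ≤ 2 * ℓ)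
    (hup : ∀ o ∈ F, ∀ z ∈ F, ∀ w ∈ F, o.2 + ℓ ≤ z.2 → o.2 + ℓ ≤ w.2 → z.1 - w.1 ≤ ℓ)
    (hdown : ∀ o ∈ F, ∀ z ∈ F, ∀ w ∈ F, z.2 + ℓ ≤ o.2 → w.2 + ℓ ≤ o.2 → z.1 - w.1 ≤ ℓ) :
    (overlapped pos ℓ F).card ≤ 7 := by
  have h1 : (overlappedSlabs pos ℓ F).card ≤ 3 :=
    card_overlappedSlabs_le 1 fun z hz w hw => by
      push_cast
      linarith [(hF z hz w hw).2]
  have h2 : ∀ y ∈ overlappedSlabs pos ℓ F, (overlappedIn pos ℓ F y).card ≤ 3 := fun y _ =>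
    card_overlappedIn_le 1 fun z hz w hw _ _ _ _ => by
      push_cast
      linarith [(hF z hz w hw).1]
  rw [card_overlapped_eq_sum]
  by_cases hcard : (overlappedSlabs pos ℓ F).card ≤ 2
  · have h3 := Finset.sum_le_card_nsmul _ _ _ h2
    simp only [smul_eq_mul] at h3
    omega
  obtain ⟨y₁, y₂, y₃, h12, h23, heq⟩ : ∃ y₁ y₂ y₃ : ℝ, y₁ < y₂ ∧ y₂ < y₃ ∧
      overlappedSlabs pos ℓ F = {y₁, y₂, y₃} := by
    have h3 : (overlappedSlabs pos ℓ F).card = 3 := by omega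
    obtain ⟨e, he⟩ : ∃ e : Fin 3 ↪o ℝ, Set.range e = overlappedSlabs pos ℓ F :=
      ⟨_, Finset.range_orderEmbOfFin _ h3⟩
    refine ⟨e 0, e 1, e 2, e.strictMono (by decide), e.strictMono (by decide), ?_⟩
    rw [← Finset.coe_inj, ← he]
    ext y
    simp [Fin.exists_fin_succ, eq_comm]
  have hm₁ : y₁ ∈ overlappedSlabs pos ℓ F := by simp [heq]
  have hm₂ : y₂ ∈ overlappedSlabs pos ℓ F := by simp [heq]
  have hm₃ : y₃ ∈ overlappedSlabs pos ℓ F := by simp [heq]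
  have hs12 := spaced_overlappedSlabs _ hm₁ _ hm₂ h12
  have hs23 := spaced_overlappedSlabs _ hm₂ _ hm₃ h23
  -- `z₁` is no higher than `y₁ + ℓ < y₂`, so points of the top slab exceed it by more than `ℓ`;
  -- `z₃` serves the bottom slab symmetrically.
  obtain ⟨z₁, hz₁, -, hle₁⟩ := exists_mem_of_mem_overlappedSlabs hm₁
  obtain ⟨z₃, hz₃, hle₃, -⟩ := exists_mem_of_mem_overlappedSlabs hm₃
  have hc₁ : (overlappedIn pos ℓ F y₁).card ≤ 2 :=
    card_overlappedIn_le 0 fun z hz w hw _ hz' _ hw' => by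
      simpa using hdown z₃ hz₃ z hz w hw (by linarith) (by linarith)
  have hc₃ : (overlappedIn pos ℓ F y₃).card ≤ 2 :=
    card_overlappedIn_le 0 fun z hz w hw hz' _ hw' _ => by
      simpa using hup z₁ hz₁ z hz w hw (by linarith) (by linarith)
  have hc₂ := h2 y₂ hm₂
  rw [heq, Finset.sum_insert (by simp [h12.ne, (h12.trans h23).ne]),
    Finset.sum_insert (by simp [h23.ne]), Finset.sum_singleton]
  omega

end Cover

/-! ### Axis-aligned and rotated squares -/

theorem axisSquare_sub_le {a : ℝ × ℝ} {ℓ : ℝ} {z w : ℝ × ℝ} (hz : z ∈ axisSquare a ℓ)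
    (hw : w ∈ axisSquare a ℓ) : z.1 - w.1 ≤ ℓ ∧ z.2 - w.2 ≤ ℓ := by
  obtain ⟨h1, h2, h3, h4⟩ := hz
  obtain ⟨g1, g2, g3, g4⟩ := hw
  constructor <;> linarith

theorem rotatedSquare_dist_sq_le {a : ℝ × ℝ} {θ ℓ : ℝ} {z w : ℝ × ℝ}
    (hz : z ∈ rotatedSquare a θ ℓ) (hw : w ∈ rotatedSquare a θ ℓ) :
    (z.1 - w.1) ^ 2 + (z.2 - w.2) ^ 2 ≤ 2 * ℓ ^ 2 := by
  obtain ⟨s, ⟨hs, hs'⟩, t, ⟨ht, ht'⟩, rfl⟩ := hz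
  obtain ⟨u, ⟨hu, hu'⟩, v, ⟨hv, hv'⟩, rfl⟩ := hw
  have h1 : (s - u) ^ 2 ≤ ℓ ^ 2 := sq_le_sq' (by linarith) (by linarith)
  have h2 : (t - v) ^ 2 ≤ ℓ ^ 2 := sq_le_sq' (by linarith) (by linarith)
  have h3 := Real.sin_sq_add_cos_sq θ
  dsimp only
  have h4 : (a.1 + s * Real.cos θ - t * Real.sin θ - (a.1 + u * Real.cos θ - v * Real.sin θ)) ^ 2
      + (a.2 + s * Real.sin θ + t * Real.cos θ - (a.2 + u * Real.sin θ + v * Real.cos θ)) ^ 2 =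
      ((s - u) ^ 2 + (t - v) ^ 2) * (Real.sin θ ^ 2 + Real.cos θ ^ 2) := by ring
  rw [h4, h3]
  linarith

theorem rotatedSquare_sub_le {a : ℝ × ℝ} {θ ℓ D : ℝ} (hD : 0 ≤ D) (hℓD : 2 * ℓ ^ 2 ≤ D ^ 2)
    {z w : ℝ × ℝ} (hz : z ∈ rotatedSquare a θ ℓ) (hw : w ∈ rotatedSquare a θ ℓ) :
    z.1 - w.1 ≤ D ∧ z.2 - w.2 ≤ D := by
  have h := rotatedSquare_dist_sq_le hz hw
  constructor
  · exact (abs_le_of_sq_le_sq' (by nlinarith [sq_nonneg (z.2 - w.2)]) hD).2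
  · exact (abs_le_of_sq_le_sq' (by nlinarith [sq_nonneg (z.1 - w.1)]) hD).2

/-- Three numbers from `[0, ℓ]`, weighted by the differences of three others: twice the area of a
triangle in the square `[0, ℓ]²` is at most `ℓ²`. -/
theorem cross_le {ℓ s₀ s₁ s₂ t₀ t₁ t₂ : ℝ} (hs₀ : s₀ ∈ Set.Icc 0 ℓ) (hs₁ : s₁ ∈ Set.Icc 0 ℓ)
    (hs₂ : s₂ ∈ Set.Icc 0 ℓ) (ht₀ : t₀ ∈ Set.Icc 0 ℓ) (ht₁ : t₁ ∈ Set.Icc 0 ℓ)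
    (ht₂ : t₂ ∈ Set.Icc 0 ℓ) :
    (s₁ - s₀) * (t₂ - t₀) - (s₂ - s₀) * (t₁ - t₀) ≤ ℓ ^ 2 := by
  obtain ⟨a₀, b₀⟩ := hs₀
  obtain ⟨a₁, b₁⟩ := hs₁
  obtain ⟨a₂, b₂⟩ := hs₂
  obtain ⟨c₀, d₀⟩ := ht₀
  obtain ⟨c₁, d₁⟩ := ht₁
  obtain ⟨c₂, d₂⟩ := ht₂
  -- The left side equals `s₀ (t₁ - t₂) + s₁ (t₂ - t₀) + s₂ (t₀ - t₁)`. Each term is at most `ℓ`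
  -- times the positive part of its coefficient, and these parts add up to the spread of the `tᵢ`.
  have key : ∀ s k : ℝ, 0 ≤ s → s ≤ ℓ → s * k ≤ ℓ * max k 0 := by
    intro s k h0 h1
    calc s * k ≤ s * max k 0 := mul_le_mul_of_nonneg_left (le_max_left _ _) h0
      _ ≤ ℓ * max k 0 := mul_le_mul_of_nonneg_right h1 (le_max_right _ _)
  have hsum : max (t₁ - t₂) 0 + max (t₂ - t₀) 0 + max (t₀ - t₁) 0 ≤ ℓ := by
    rcases max_cases (t₁ - t₂) 0 with h | h <;> rcases max_cases (t₂ - t₀) 0 with h' | h' <;>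
      rcases max_cases (t₀ - t₁) 0 with h'' | h'' <;> linarith
  have h0 := key s₀ (t₁ - t₂) a₀ b₀
  have h1 := key s₁ (t₂ - t₀) a₁ b₁
  have h2 := key s₂ (t₀ - t₁) a₂ b₂
  have h3 := mul_le_mul_of_nonneg_left hsum (a₀.trans b₀)
  linarith

/-- Twice the area of a triangle in a square of side `ℓ` is at most `ℓ²`. -/
theorem rotatedSquare_cross_le {a : ℝ × ℝ} {θ ℓ : ℝ} {o z w : ℝ × ℝ}
    (ho : o ∈ rotatedSquare a θ ℓ) (hz : z ∈ rotatedSquare a θ ℓ)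
    (hw : w ∈ rotatedSquare a θ ℓ) :
    (z.1 - o.1) * (w.2 - o.2) - (w.1 - o.1) * (z.2 - o.2) ≤ ℓ ^ 2 := by
  obtain ⟨s₀, hs₀, t₀, ht₀, rfl⟩ := ho
  obtain ⟨s₁, hs₁, t₁, ht₁, rfl⟩ := hz
  obtain ⟨s₂, hs₂, t₂, ht₂, rfl⟩ := hw
  have h := cross_le hs₀ hs₁ hs₂ ht₀ ht₁ ht₂
  rw [← mul_one ((s₁ - s₀) * (t₂ - t₀) - (s₂ - s₀) * (t₁ - t₀)),
    ← Real.sin_sq_add_cos_sq θ] at h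
  dsimp only
  linarith

/-- Two vectors that rise by at least `ℓ`, are no longer than `√2 ℓ` and span a triangle of area at
most `ℓ² / 2` have abscissas that differ by at most `ℓ`. -/
theorem sub_le_of_cross_le {ℓ x₁ x₂ h₁ h₂ : ℝ} (hℓ : 0 < ℓ) (hh₁ : ℓ ≤ h₁) (hh₂ : ℓ ≤ h₂)
    (hn₁ : x₁ ^ 2 + h₁ ^ 2 ≤ 2 * ℓ ^ 2) (hn₂ : x₂ ^ 2 + h₂ ^ 2 ≤ 2 * ℓ ^ 2)
    (hc : x₁ * h₂ - x₂ * h₁ ≤ ℓ ^ 2) : x₁ - x₂ ≤ ℓ := by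
  have hx₁ : x₁ ≤ ℓ := (abs_le_of_sq_le_sq' (by nlinarith) hℓ.le).2
  have hx₂ : -x₂ ≤ ℓ := (abs_le_of_sq_le_sq' (by nlinarith) hℓ.le).2
  rcases le_total x₁ 0 with h1 | h1
  · linarith
  rcases le_total 0 x₂ with h2 | h2
  · linarith
  -- With `x₂ ≤ 0 ≤ x₁`, `ℓ (x₁ - x₂) ≤ x₁ h₂ - x₂ h₁ ≤ ℓ²`.
  nlinarith [mul_le_mul_of_nonneg_left hh₂ h1, mul_le_mul_of_nonneg_left hh₁ (neg_nonneg.2 h2)]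

theorem card_overlapped_rotatedSquare_le {N : ℕ} {pos : Fin N → ℝ × ℝ} {ℓ : ℝ} (hℓ : 0 < ℓ)
    (a : ℝ × ℝ) (θ : ℝ) : (overlapped pos ℓ (rotatedSquare a θ ℓ)).card ≤ 7 := by
  refine card_overlapped_le_seven
    (fun z hz w hw => rotatedSquare_sub_le (by linarith) (by nlinarith) hz hw) ?_ ?_
  · intro o ho z hz w hw hoz how
    have := sub_le_of_cross_le hℓ (by linarith) (by linarith) (rotatedSquare_dist_sq_le hz ho)
      (rotatedSquare_dist_sq_le hw ho) (rotatedSquare_cross_le ho hz hw)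
    linarith
  · intro o ho z hz w hw hoz how
    -- The vectors now run up to `o`, which reverses the order of `z` and `w`.
    have := sub_le_of_cross_le (x₁ := o.1 - w.1) (x₂ := o.1 - z.1) (h₁ := o.2 - w.2)
      (h₂ := o.2 - z.2) hℓ (by linarith) (by linarith) (rotatedSquare_dist_sq_le ho hw)
      (rotatedSquare_dist_sq_le ho hz) (by linarith [rotatedSquare_cross_le ho hw hz])
    linarith

end Geoconsensus

end

theorem mainTheorem4 (N : ℕ) (pos : Fin N → ℝ × ℝ) (hpos : Function.Injective pos)
    (ℓ : ℝ) (hℓ : 0 < ℓ) :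
    (22 ≤ (Geoconsensus.coverSet pos ℓ).card →
      ∀ (a : ℝ × ℝ) (θ : ℝ),
        (Geoconsensus.covered pos (Geoconsensus.rotatedSquare a θ ℓ)).card + 15 ≤ N ∧
        Geoconsensus.SolvesGeoconsensus (Geoconsensus.generic pos ℓ 7) pos
          (Geoconsensus.rotatedSquare a θ ℓ) ∧
        Geoconsensus.DecidesWithin (Geoconsensus.generic pos ℓ 7) pos
          (Geoconsensus.rotatedSquare a θ ℓ) (7 + 2)) ∧
    (13 ≤ (Geoconsensus.coverSet pos ℓ).card →
      ∀ a : ℝ × ℝ,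
        (Geoconsensus.covered pos (Geoconsensus.axisSquare a ℓ)).card + 9 ≤ N ∧
        Geoconsensus.SolvesGeoconsensus (Geoconsensus.generic pos ℓ 4) pos
          (Geoconsensus.axisSquare a ℓ) ∧
        Geoconsensus.DecidesWithin (Geoconsensus.generic pos ℓ 4) pos
          (Geoconsensus.axisSquare a ℓ) (4 + 2)) ∧
    (13 ≤ (Geoconsensus.coverSet pos ℓ).card →
      ∀ (a : ℝ × ℝ) (θ : ℝ),
        (Geoconsensus.covered pos (Geoconsensus.rotatedSquare a θ (ℓ / √2))).card + 9 ≤ N ∧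
        Geoconsensus.SolvesGeoconsensus (Geoconsensus.generic pos ℓ 4) pos
          (Geoconsensus.rotatedSquare a θ (ℓ / √2)) ∧
        Geoconsensus.DecidesWithin (Geoconsensus.generic pos ℓ 4) pos
          (Geoconsensus.rotatedSquare a θ (ℓ / √2)) (4 + 2)) := by

  refine ⟨fun hA a θ => ?_, fun hA a => ?_, fun hA a θ => ?_⟩
  · exact Geoconsensus.generic_guarantees hpos hℓ hA
      (Geoconsensus.card_overlapped_rotatedSquare_le hℓ a θ)
  · exact Geoconsensus.generic_guarantees hpos hℓ hA
      (Geoconsensus.card_overlapped_le_four fun z hz w hw =>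
        Geoconsensus.axisSquare_sub_le hz hw)
  -- The diagonal of this square is `ℓ`, so its projections to the axes never exceed `ℓ`, whatever
  -- the rotation.
  · have hside : 2 * (ℓ / √2) ^ 2 ≤ ℓ ^ 2 := by
      rw [div_pow, Real.sq_sqrt zero_le_two]
      linarith
    exact Geoconsensus.generic_guarantees hpos hℓ hA
      (Geoconsensus.card_overlapped_le_four fun z hz w hw =>
        Geoconsensus.rotatedSquare_sub_le hℓ.le hside hz hw)
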